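/- Let $\mathbb T=\{z\in\mathbb C:|z|=1\}$, and let $(D_n)_{n\ge 1}$ be a sequence of open discs in $\mathbb C$ of positive radii (not necessarily pairwise disjoint) whose closures are contained in the open unit disc $\{z\in\mathbb C:|z|<1\}$. Put $$X=\{z\in\mathbb C:|z|\le 1\}\setminus\bigcup_{n=1}^\infty D_n .$$ Let $r_n$ be the radius of $D_n$ and let $s_n=\inf\{|z-w|:z\in D_n,\ w\in\mathbb T\}$ be the distance from $D_n$ to $\mathbb T$. Let $R_0(X)$ denote the set of restrictions to $X$ of rational functions with no poles on $X$, and let $|f|_X=\sup_{x\in X}|f(x)|$. Then for all $f,g\in R_0(X)$, $$\left|\int_{\mathbb T}f'(z)\,g(z)\,dz\right|\le 4\pi\,|f|_X\,|g|_X\sum_{n=1}^\infty\frac{r_n}{s_n^2},$$ where $\mathbb T$ is traversed once counterclockwise, $f'$ is the derivative of the rational function restricting to $f$, the sum is an element of $[0,\infty]$, and $0\cdot\infty=0$ on the right-hand side. -/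

import Mathlib

open scoped ENNReal

namespace SwissCheese

/-- Functions whose restriction to `X` belongs to `R₀(X)`: on `X` they agree with a rational
function with no pole on `X`. A function on `X` is given by a function on `ℂ`, of which
only the values on `X` matter. -/
def R0 (X : Set ℂ) : Set (ℂ → ℂ) :=
  {f | ∃ p q : Polynomial ℂ, (∀ z ∈ X, q.eval z ≠ 0) ∧ ∀ z ∈ X, f z = p.eval z / q.eval z}

/-- The uniform norm `|f|_S = sup {|f(x)| : x ∈ S}` (for `f` bounded on `S`, `S` non-empty). -/
noncomputable def unifNorm (S : Set ℂ) (f : ℂ → ℂ) : ℝ :=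
  ⨆ x : S, ‖f x‖

/-- The distance `inf {|z - w| : z ∈ A, w ∈ B}` between two non-empty plane sets. -/
noncomputable def setDist (A B : Set ℂ) : ℝ :=
  ⨅ x : A × B, dist (x.1 : ℂ) (x.2 : ℂ)

/-- The closed unit disc with the open discs of centre `c n` and radius `r n` removed. -/
def cheese (c : ℕ → ℂ) (r : ℕ → ℝ) : Set ℂ :=
  Metric.closedBall 0 1 \ ⋃ n, Metric.ball (c n) (r n)

/-- At a non-isolated point of `X`, the derivative within `X` of a function in `R₀(X)` is the
derivative of any rational function that restricts to it. -/
theorem derivWithin_eq {X : Set ℂ} {f : ℂ → ℂ} {p q : Polynomial ℂ}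
    (hq : ∀ z ∈ X, q.eval z ≠ 0) (hf : ∀ z ∈ X, f z = p.eval z / q.eval z)
    {z : ℂ} (hz : z ∈ X) (hacc : AccPt z (Filter.principal X)) :
    derivWithin f X z = deriv (fun w => p.eval w / q.eval w) z := by
  have hd : DifferentiableAt ℂ (fun w => p.eval w / q.eval w) z :=
    p.differentiable.differentiableAt.div q.differentiable.differentiableAt (hq z hz)
  rw [derivWithin_congr hf (hf z hz)]
  exact hd.derivWithin (uniqueDiffWithinAt_iff_accPt.2 hacc)

end SwissCheese

/-!
Suppose first that there are finitely many discs, and let `ρ < 1` be such that all of them lie in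
`|w| < ρ`. Moving contours in the annulus between the circle `|w| = ρ` and a circle slightly larger
than the unit circle `T` gives (`circleIntegral_deriv_mul_eq`)
`2πi ∮_T f' g = ∮_T f(z) Kg(z) dz - ∮_T g(z) Kf(z) dz`, where
`Kf(z) = ∮_{|w| = ρ} f(w) / (w - z)² dw`.

For `z` on `T` the integrand of `Kf(z)` is holomorphic in `w` off the discs, so `Kf(z)` is an
integral over the boundary of the union of the discs; on the part of it that lies on the `n`-th
circle the integrand is at most `|f| / s_n²`, which gives `|Kf(z)| ≤ 2π |f| ∑ r_n / s_n²`. Each of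
the two terms of the identity is therefore at most `(2π)² |f| |g| ∑ r_n / s_n²`.

The discs may overlap, and the boundary of their union is not parametrized. Instead
`norm_circleIntegral_le_sum_radii` multiplies the integrand by a product of radial cutoffs, one for
each disc, and applies Green's formula: the gradient of a cutoff that rises from `0` to `1` within
the `n`-th disc has integral at most `2π r_n`.

Finally, infinitely many discs are handled by compactness (`exists_finite_shrunk_discs`): for every
`ε > 0`, both functions are holomorphic with norms at most `|f| + ε` and `|g| + ε` once finitely many
of the discs, slightly shrunk, have been removed.
-/

/-! ### Green's formula on a disc -/

open Complex MeasureTheory Set Metric in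
/-- **Green's formula on a disc**: `I * ψ' w 1 - ψ' w I` is `2 * I` times the derivative of `ψ`
with respect to the conjugate variable. The proof applies the divergence theorem in polar
coordinates, on the rectangle `[0, R] × [-π, π]`. -/
theorem circleIntegral_eq_setIntegral_ball {ψ : ℂ → ℂ} {ψ' : ℂ → ℂ →L[ℝ] ℂ} {R : ℝ} (hR : 0 ≤ R)
    (hc : ContinuousOn ψ (closedBall 0 R))
    (hd : ∀ w ∈ ball (0 : ℂ) R, HasFDerivAt ψ (ψ' w) w)
    (hi : ContinuousOn (fun w => I * ψ' w 1 - ψ' w I) (closedBall 0 R)) :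
    (∮ w in C(0, R), ψ w) = ∫ w in ball (0 : ℂ) R, (I * ψ' w 1 - ψ' w I) := by
  set b : ℂ → ℂ := fun w => I * ψ' w 1 - ψ' w I with hb
  let E : ℝ × ℝ → ℂ := fun p => exp (p.2 * I)
  let E' : ℝ × ℝ → ℝ × ℝ →L[ℝ] ℂ := fun p =>
    (ContinuousLinearMap.snd ℝ ℝ ℝ).smulRight (E p * I)
  let P : ℝ × ℝ → ℂ := fun p => p.1 * E p
  let P' : ℝ × ℝ → ℝ × ℝ →L[ℝ] ℂ := fun p =>
    (ContinuousLinearMap.fst ℝ ℝ ℝ).smulRight (E p) + (p.1 : ℂ) • E' p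
  have hE : ∀ p, HasFDerivAt E (E' p) p := by
    intro p
    have h1 : HasDerivAt (fun y : ℝ => exp (y * I)) (exp (p.2 * I) * I) p.2 := by
      have := ((hasDerivAt_id p.2).ofReal_comp.mul_const I).cexp
      simpa using this
    have h2 := h1.hasFDerivAt.comp p (hasFDerivAt_snd (𝕜 := ℝ) (E := ℝ) (F := ℝ) (p := p))
    refine h2.congr_fderiv ?_
    ext <;> simp [E', E]
  have hx : ∀ p : ℝ × ℝ, HasFDerivAt (fun p : ℝ × ℝ => (p.1 : ℂ))
      ((ContinuousLinearMap.fst ℝ ℝ ℝ).smulRight (1 : ℂ)) p := by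
    intro p
    have := (ofRealCLM.hasFDerivAt (x := p.1)).comp p
      (hasFDerivAt_fst (𝕜 := ℝ) (E := ℝ) (F := ℝ) (p := p))
    refine this.congr_fderiv ?_
    ext <;> simp
  have hP : ∀ p, HasFDerivAt P (P' p) p := by
    intro p
    refine ((hx p).mul (hE p)).congr_fderiv ?_
    ext <;> simp [P', E']
  have hEn : ∀ p, ‖E p‖ = 1 := fun p => norm_exp_ofReal_mul_I _
  have hPn : ∀ p, ‖P p‖ = |p.1| := fun p => by simp [P, hEn]
  have hEc : Continuous E := by fun_prop
  have hPc : Continuous P := by fun_prop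
  have hmap : MapsTo P (uIcc 0 R ×ˢ uIcc (-Real.pi) Real.pi) (closedBall 0 R) := by
    rintro ⟨x, y⟩ ⟨h1, -⟩
    rw [uIcc_of_le hR] at h1
    simp only [mem_closedBall, dist_zero_right, hPn]
    rw [abs_of_nonneg h1.1]; exact h1.2
  have hmap' : MapsTo P
      (Ioo (min 0 R) (max 0 R) ×ˢ Ioo (min (-Real.pi) Real.pi) (max (-Real.pi) Real.pi))
      (ball 0 R) := by
    rintro ⟨x, y⟩ ⟨h1, -⟩
    rw [min_eq_left hR, max_eq_right hR] at h1
    simp only [mem_ball, dist_zero_right, hPn]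
    rw [abs_of_pos h1.1]; exact h1.2
  -- In polar coordinates the field `(ψ(P) * I * P, -ψ(P) * E)` has divergence `x * b(P)`. Of its
  -- boundary terms the one at `x = 0` vanishes and those at `y = ±π` cancel.
  have key : ∀ p : ℝ × ℝ,
      ((ψ (P p)) • (I • P' p) + ((I * P p) • ((ψ' (P p)).comp (P' p)))) (1, 0)
        + (-((ψ (P p)) • (E' p) + (E p) • ((ψ' (P p)).comp (P' p)))) (0, 1)
        = p.1 • b (P p) := by
    intro p
    have hlin : ∀ v : ℂ, ψ' (P p) v = v.re * ψ' (P p) 1 + v.im * ψ' (P p) I := by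
      intro v
      conv_lhs => rw [show v = v.re • (1 : ℂ) + v.im • I by simp]
      rw [map_add, map_smul, map_smul]; simp
    have hsq : E p * ((E p).re - (E p).im * I) = 1 := by
      have : ((E p).re - (E p).im * I : ℂ) = (starRingEnd ℂ) (E p) := by
        apply Complex.ext <;> simp
      rw [this, mul_conj, normSq_eq_norm_sq, hEn]; simp
    have e1 : (P' p) (1, 0) = E p := by simp [P', E']
    have e2 : (P' p) (0, 1) = p.1 * (E p * I) := by simp [P', E']
    have e3 : (E' p) (0, 1) = E p * I := by simp [E']
    simp only [add_apply, smul_apply,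
      ContinuousLinearMap.comp_apply, neg_apply, e1, e2, e3, smul_eq_mul]
    rw [hlin (E p), hlin (p.1 * (E p * I))]
    simp only [hb, P, real_smul]
    simp only [mul_re, mul_im, ofReal_re, ofReal_im, I_re, I_im]
    push_cast
    linear_combination (p.1 : ℂ) * (I * ψ' (p.1 * E p) 1 - ψ' (p.1 * E p) I) * hsq +
      (p.1 * E p * (E p).im * ψ' (p.1 * E p) 1) * I_sq
  have hdiv := integral2_divergence_prod_of_hasFDerivAt
    (fun p => ψ (P p) * (I * P p)) (fun p => -(ψ (P p) * E p))
    (fun p => (ψ (P p)) • (I • P' p) + ((I * P p) • ((ψ' (P p)).comp (P' p))))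
    (fun p => -((ψ (P p)) • (E' p) + (E p) • ((ψ' (P p)).comp (P' p))))
    0 (-Real.pi) R Real.pi
    ((hc.comp hPc.continuousOn hmap).mul (by fun_prop))
    ((hc.comp hPc.continuousOn hmap).mul (by fun_prop)).neg
    (fun p hp => ((hd _ (hmap' hp)).comp p (hP p)).mul ((hP p).const_mul I))
    (fun p hp => (((hd _ (hmap' hp)).comp p (hP p)).mul (hE p)).neg)
    (by
      simp only [key]
      refine ContinuousOn.integrableOn_compact (isCompact_uIcc.prod isCompact_uIcc) ?_
      exact continuous_fst.continuousOn.smul (hi.comp hPc.continuousOn hmap))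
  simp only [key] at hdiv
  have hper : ∀ x : ℝ, P (x, Real.pi) = P (x, -Real.pi) := by
    intro x; simp [P, E, exp_neg]
  have hper' : ∀ x : ℝ, E (x, Real.pi) = E (x, -Real.pi) := by
    intro x; simp [E, exp_neg]
  simp only [hper, hper', sub_self, zero_add] at hdiv
  have h0 : ∀ y : ℝ, P (0, y) = 0 := by intro y; simp [P]
  simp only [h0, mul_zero, intervalIntegral.integral_zero, sub_zero] at hdiv
  have hcirc : (∮ w in C(0, R), ψ w) = ∫ y in (-Real.pi)..Real.pi, ψ (P (R, y)) * (I * P (R, y)) := by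
    have hp : Function.Periodic (fun y : ℝ => deriv (circleMap 0 R) y • ψ (circleMap 0 R y))
        (2 * Real.pi) := by
      intro y
      simp only [deriv_circleMap, periodic_circleMap 0 R y]
    have := hp.intervalIntegral_add_eq 0 (-Real.pi)
    rw [zero_add, show -Real.pi + 2 * Real.pi = Real.pi by ring] at this
    rw [circleIntegral, this]
    refine intervalIntegral.integral_congr fun y _ => ?_
    simp only [deriv_circleMap, circleMap, P, E, zero_add, smul_eq_mul]; ring
  rw [hcirc, ← hdiv]
  have hpol := Complex.integral_comp_polarCoord_symm ((ball (0 : ℂ) R).indicator b)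
  rw [integral_indicator measurableSet_ball] at hpol
  rw [← hpol]
  have hset : ∀ p ∈ polarCoord.target, p.1 • (ball (0 : ℂ) R).indicator b (Complex.polarCoord.symm p)
      = (Iio R ×ˢ (univ : Set ℝ)).indicator (fun p => p.1 • b (P p)) p := by
    rintro ⟨x, y⟩ hp
    have hxpos : 0 < x := by simpa using hp.1
    have hs : Complex.polarCoord.symm (x, y) = P (x, y) := by
      rw [Complex.polarCoord_symm_apply]; simp only [P, E, exp_mul_I]; push_cast; rfl
    rw [hs]
    by_cases h : x < R
    · rw [indicator_of_mem, indicator_of_mem]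
      · exact ⟨h, mem_univ _⟩
      · rw [mem_ball, dist_zero_right, hPn, abs_of_pos hxpos]; exact h
    · rw [indicator_of_notMem, indicator_of_notMem, smul_zero]
      · exact fun h' => h h'.1
      · rw [mem_ball, dist_zero_right, hPn, abs_of_pos hxpos]; exact h
  rw [setIntegral_congr_fun polarCoord.open_target.measurableSet hset,
    setIntegral_indicator (measurableSet_Iio.prod MeasurableSet.univ)]
  have hint : IntegrableOn (fun p : ℝ × ℝ => p.1 • b (P p))
      (uIcc 0 R ×ˢ uIcc (-Real.pi) Real.pi) := by
    refine ContinuousOn.integrableOn_compact (isCompact_uIcc.prod isCompact_uIcc) ?_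
    exact continuous_fst.continuousOn.smul (hi.comp hPc.continuousOn hmap)
  have hsets : polarCoord.target ∩ Iio R ×ˢ univ = Ioo 0 R ×ˢ Ioo (-Real.pi) Real.pi := by
    ext ⟨x, y⟩; simp [polarCoord_target]; tauto
  have hpi : -Real.pi ≤ Real.pi := by linarith [Real.pi_pos]
  rw [hsets, Measure.volume_eq_prod, setIntegral_prod _ (hint.mono_set ?_),
    intervalIntegral.integral_of_le hR, integral_Ioc_eq_integral_Ioo]
  · refine setIntegral_congr_fun measurableSet_Ioo fun x _ => ?_
    simp only
    rw [intervalIntegral.integral_of_le hpi, integral_Ioc_eq_integral_Ioo]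
  · rw [uIcc_of_le hR, uIcc_of_le hpi]
    exact prod_mono Ioo_subset_Icc_self Ioo_subset_Icc_self

/-! ### Contour integrals around a union of discs -/

open MeasureTheory Set Metric in
/-- A `C¹` radial cutoff `χ` around `c`, vanishing on the disc of radius `a` and equal to `1` outside
the disc of radius `r`, with gradient `D`. Since `χ` is radially monotone, the integral of `‖D‖`
is at most the perimeter `2πr`, however close `a` is to `r`. -/
theorem exists_radial_cutoff (c : ℂ) {a r : ℝ} (ha : 0 ≤ a) (har : a < r) :
    ∃ (χ : ℂ → ℝ) (D : ℂ → ℂ), Continuous D ∧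
      (∀ w, HasFDerivAt χ (innerSL ℝ (D w)) w) ∧ (∀ w, 0 ≤ χ w ∧ χ w ≤ 1) ∧
      (∀ w, dist w c ≤ a → χ w = 0) ∧ (∀ w, r ≤ dist w c → χ w = 1) ∧
      (∀ w, D w ≠ 0 → a < dist w c ∧ dist w c < r) ∧
      Integrable (fun w => ‖D w‖) ∧ ∫ w, ‖D w‖ ≤ 2 * Real.pi * r := by
  have hr : 0 < r := ha.trans_lt har
  have hpos : 0 < r ^ 2 - a ^ 2 := by nlinarith
  let η : ℝ → ℝ := fun u => Real.smoothTransition ((u - a ^ 2) / (r ^ 2 - a ^ 2))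
  have hηc : ContDiff ℝ 1 η := by
    have : ContDiff ℝ 1 Real.smoothTransition := Real.smoothTransition.contDiff (n := 1)
    exact this.comp (by fun_prop)
  have hηm : Monotone η := Real.smoothTransition.monotone.comp fun x y h => by gcongr
  have hη0 : ∀ u, u ≤ a ^ 2 → η u = 0 := fun u hu =>
    Real.smoothTransition.zero_of_nonpos (div_nonpos_of_nonpos_of_nonneg (by linarith) hpos.le)
  have hη1 : ∀ u, r ^ 2 ≤ u → η u = 1 := fun u hu =>
    Real.smoothTransition.one_of_one_le ((one_le_div hpos).2 (by linarith))
  have hηd : ∀ u, HasDerivAt η (deriv η u) u := fun u =>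
    (hηc.differentiable (by norm_num) u).hasDerivAt
  have hη' : Continuous (deriv η) := hηc.continuous_deriv le_rfl
  have hη'n : ∀ u, 0 ≤ deriv η u := fun u => hηm.deriv_nonneg
  -- Continuity of the derivative extends its vanishing to the end points.
  have hd0 : ∀ u, u ≤ a ^ 2 → deriv η u = 0 := by
    intro u hu
    have h : EqOn (deriv η) 0 (Iio (a ^ 2)) := fun v hv => by
      have : η =ᶠ[nhds v] fun _ => 0 := by
        filter_upwards [Iio_mem_nhds hv] with x hx using hη0 x (le_of_lt hx)
      rw [this.deriv_eq]; simp
    have := h.closure hη' continuous_zero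
    rw [closure_Iio] at this
    exact this hu
  have hd1 : ∀ u, r ^ 2 ≤ u → deriv η u = 0 := by
    intro u hu
    have h : EqOn (deriv η) 0 (Ioi (r ^ 2)) := fun v hv => by
      have : η =ᶠ[nhds v] fun _ => 1 := by
        filter_upwards [Ioi_mem_nhds hv] with x hx using hη1 x (le_of_lt hx)
      rw [this.deriv_eq]; simp
    have := h.closure hη' continuous_zero
    rw [closure_Ioi] at this
    exact this hu
  let χ : ℂ → ℝ := fun w => η (‖w - c‖ ^ 2)
  let D : ℂ → ℂ := fun w => (2 * deriv η (‖w - c‖ ^ 2)) • (w - c)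
  have hDc : Continuous D := by fun_prop
  have hDsupp : ∀ w, D w ≠ 0 → a < dist w c ∧ dist w c < r := by
    intro w hw
    rw [dist_eq_norm]
    constructor
    · by_contra! h
      exact hw (by simp only [D]; rw [hd0 _ (by gcongr)]; simp)
    · by_contra! h
      exact hw (by simp only [D]; rw [hd1 _ (by gcongr)]; simp)
  refine ⟨χ, D, hDc, ?_, ?_, ?_, ?_, hDsupp, ?_, ?_⟩
  · intro w
    have h1 : HasFDerivAt (fun w : ℂ => ‖w - c‖ ^ 2) _ w :=
      ((hasFDerivAt_id (𝕜 := ℝ) w).sub_const c).norm_sq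
    refine ((hηd (‖w - c‖ ^ 2)).comp_hasFDerivAt w h1).congr_fderiv ?_
    ext v
    simp [D]; ring
  · exact fun w => ⟨Real.smoothTransition.nonneg _, Real.smoothTransition.le_one _⟩
  · intro w hw
    rw [dist_eq_norm] at hw
    exact hη0 _ (by gcongr)
  · intro w hw
    rw [dist_eq_norm] at hw
    exact hη1 _ (by gcongr)
  · refine hDc.norm.integrable_of_hasCompactSupport ?_
    refine HasCompactSupport.of_support_subset_isCompact (isCompact_closedBall c r) ?_
    intro w hw
    exact (hDsupp w (by simpa using hw)).2.le
  -- In polar coordinates the integral is `2π ∫ y h'(y) dy`, where `h'` is the derivative of the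
  -- radial profile, which increases from `0` to `1` on `[0, r]`.
  · let h' : ℝ → ℝ := fun y => deriv η (y ^ 2) * (2 * y)
    have hh : ∀ y : ℝ, HasDerivAt (fun y => η (y ^ 2)) (h' y) y := by
      intro y
      have := (hηd (y ^ 2)).comp y (hasDerivAt_pow 2 y)
      simpa [h', Function.comp_def] using this
    have hh'c : Continuous h' := by fun_prop
    have hnorm : ∀ w, ‖D w‖ = h' ‖w - c‖ := by
      intro w
      simp only [D, h', norm_smul, Real.norm_eq_abs, abs_mul, abs_of_nonneg (hη'n _)]
      simp; ring
    simp_rw [hnorm]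
    rw [integral_sub_right_eq_self (fun w : ℂ => h' ‖w‖) c, integral_fun_norm_addHaar]
    have hvol : volume.real (ball (0 : ℂ) 1) = Real.pi := by
      simp [Measure.real, Complex.volume_ball]
    rw [hvol, Complex.finrank_real_complex]
    have hsub : ∫ y in Ioi (0 : ℝ), y ^ (2 - 1) • h' y = ∫ y in Ioc 0 r, y * h' y := by
      rw [← Ioc_union_Ioi_eq_Ioi hr.le]
      rw [setIntegral_eq_of_subset_of_forall_sdiff_eq_zero (s := Ioc 0 r)
        (measurableSet_Ioc.union measurableSet_Ioi) subset_union_left]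
      · simp
      · rintro y ⟨h1 | h1, h2⟩
        · exact absurd h1 h2
        · have : r ^ 2 ≤ y ^ 2 := by have := mem_Ioi.1 h1; gcongr
          simp [h', hd1 _ this]
    rw [hsub, ← intervalIntegral.integral_of_le hr.le]
    have hle : ∫ y in (0 : ℝ)..r, y * h' y ≤ ∫ y in (0 : ℝ)..r, r * h' y := by
      refine intervalIntegral.integral_mono_on hr.le
        (Continuous.intervalIntegrable (by fun_prop) _ _)
        (Continuous.intervalIntegrable (by fun_prop) _ _) fun y hy => ?_
      exact mul_le_mul_of_nonneg_right hy.2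
        (mul_nonneg (hη'n _) (by linarith [hy.1]))
    have hval : ∫ y in (0 : ℝ)..r, r * h' y = r := by
      rw [intervalIntegral.integral_const_mul,
        intervalIntegral.integral_eq_sub_of_hasDerivAt (fun y _ => hh y)
          (hh'c.intervalIntegrable _ _), hη1 _ le_rfl, hη0 _ (by nlinarith)]
      ring
    rw [hval] at hle
    simp only [nsmul_eq_mul, smul_eq_mul]
    push_cast
    nlinarith [Real.pi_pos, mul_le_mul_of_nonneg_left hle Real.pi_pos.le]

open Complex MeasureTheory Set Metric in
/-- A substitute for Cauchy's theorem on the boundary of a union of discs: an integral over a circle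
enclosing the discs `ball (c n) (r n)` is bounded as if it were moved to their boundary, the part of
the boundary on the `n`-th circle contributing at most `C n * (2πr n)`. The discs may overlap, and
`φ` has to be holomorphic only off the slightly smaller discs of radii `a n`. -/
theorem norm_circleIntegral_le_sum_radii {ι : Type*} (s : Finset ι) (c : ι → ℂ) (a r C : ι → ℝ)
    (ha : ∀ n ∈ s, 0 ≤ a n) (har : ∀ n ∈ s, a n < r n) {R : ℝ} (hR : 0 ≤ R)
    (hball : ∀ n ∈ s, ball (c n) (r n) ⊆ ball 0 R) (φ : ℂ → ℂ) (hC : ∀ n ∈ s, 0 ≤ C n)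
    (hφ : ∀ w ∈ closedBall (0 : ℂ) R, (∀ n ∈ s, a n ≤ dist w (c n)) → DifferentiableAt ℂ φ w)
    (hφC : ∀ n ∈ s, ∀ w ∈ ball (c n) (r n), (∀ m ∈ s, a m ≤ dist w (c m)) → ‖φ w‖ ≤ C n) :
    ‖∮ w in C(0, R), φ w‖ ≤ 2 * Real.pi * ∑ n ∈ s, C n * r n := by
  classical
  have hex := fun n : s => exists_radial_cutoff (c n) (ha n n.2) (har n n.2)
  choose χ D hDc hχD hχ01 hχ0 hχ1 hDsupp hDint hDle using hex
  -- The product of the cutoffs vanishes where `φ` may be singular, and by the product rule its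
  -- gradient `G` is bounded by the sum of the individual gradients.
  let X : ℂ → ℝ := fun w => ∏ n, χ n w
  let G : ℂ → ℂ := fun w => ∑ n, (∏ m ∈ Finset.univ.erase n, χ m w) • D n w
  have hχc : ∀ n, Continuous (χ n) := fun n =>
    continuous_iff_continuousAt.2 fun w => (hχD n w).continuousAt
  have hXc : Continuous X := by fun_prop
  have hGc : Continuous G := by fun_prop
  have hX : ∀ w, HasFDerivAt X (innerSL ℝ (G w)) w := by
    intro w
    refine (HasFDerivAt.finsetProd (u := Finset.univ) fun n _ => hχD n w).congr_fderiv ?_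
    ext v
    simp only [G, sum_apply, smul_apply, innerSL_apply_apply, sum_inner, real_inner_smul_left,
      smul_eq_mul]
  have hprod01 : ∀ (t : Finset s) w, 0 ≤ ∏ m ∈ t, χ m w ∧ ∏ m ∈ t, χ m w ≤ 1 := fun t w =>
    ⟨Finset.prod_nonneg fun m _ => (hχ01 m w).1,
      Finset.prod_le_one (fun m _ => (hχ01 m w).1) fun m _ => (hχ01 m w).2⟩
  have hdich : ∀ w ∈ closedBall (0 : ℂ) R, DifferentiableAt ℂ φ w ∨ X =ᶠ[nhds w] 0 := by
    intro w hw
    by_cases h : ∀ n ∈ s, a n ≤ dist w (c n)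
    · exact Or.inl (hφ w hw h)
    · push Not at h
      obtain ⟨n, hn, hlt⟩ := h
      right
      filter_upwards [isOpen_ball.mem_nhds (mem_ball.2 hlt)] with v hv
      exact Finset.prod_eq_zero (Finset.mem_univ ⟨n, hn⟩) (hχ0 ⟨n, hn⟩ v (mem_ball.1 hv).le)
  have hG0 : ∀ w, X =ᶠ[nhds w] 0 → G w = 0 := by
    intro w h
    have h1 := (hX w).congr_of_eventuallyEq h.symm
    have h2 : HasFDerivAt (0 : ℂ → ℝ) (0 : ℂ →L[ℝ] ℝ) w := hasFDerivAt_const 0 w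
    have := h1.unique h2
    have h3 : innerSL ℝ (G w) (G w) = 0 := by rw [this]; simp
    simpa using h3
  let ψ : ℂ → ℂ := fun w => X w * φ w
  let ψ' : ℂ → ℂ →L[ℝ] ℂ := fun w =>
    (X w : ℂ) • ((ContinuousLinearMap.toSpanSingleton ℂ (deriv φ w)).restrictScalars ℝ) +
      (φ w) • (ofRealCLM.comp (innerSL ℝ (G w)))
  have hψ : ∀ w ∈ closedBall (0 : ℂ) R, HasFDerivAt ψ (ψ' w) w := by
    intro w hw
    rcases hdich w hw with h | h
    · exact (ofRealCLM.hasFDerivAt.comp w (hX w)).mul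
        (h.hasDerivAt.hasFDerivAt.restrictScalars ℝ)
    · have h1 : ψ =ᶠ[nhds w] fun _ => 0 := by
        filter_upwards [h] with v hv
        simp [ψ, hv]
      have h2 : ψ' w = 0 := by
        ext v
        simp [ψ', hG0 w h, h.eq_of_nhds]
      rw [h2]
      exact (hasFDerivAt_const (0 : ℂ) w).congr_of_eventuallyEq h1
  -- `φ` being holomorphic, only the gradient of the cutoff contributes.
  have hb : ∀ w, I * ψ' w 1 - ψ' w I = I * (φ w * G w) := by
    intro w
    have hG := re_add_im (G w)
    simp only [ψ', add_apply, smul_apply, ContinuousLinearMap.comp_apply]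
    simp [Complex.inner]
    linear_combination (I * φ w) * hG - φ w * (G w).im * I_sq
  have hcont : ContinuousOn (fun w => I * ψ' w 1 - ψ' w I) (closedBall 0 R) := by
    simp only [hb]
    intro w hw
    apply ContinuousAt.continuousWithinAt
    rcases hdich w hw with h | h
    · exact continuousAt_const.mul (h.continuousAt.mul hGc.continuousAt)
    · have : (fun w => I * (φ w * G w)) =ᶠ[nhds w] fun _ => 0 := by
        filter_upwards [h.eventuallyEq_nhds] with v hv
        simp [hG0 v hv]
      exact continuousAt_const.congr this.symm
  have hgreen := circleIntegral_eq_setIntegral_ball hR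
    (fun w hw => (hψ w hw).continuousAt.continuousWithinAt)
    (fun w hw => hψ w (ball_subset_closedBall hw)) hcont
  have hcirc : (∮ w in C(0, R), φ w) = ∮ w in C(0, R), ψ w := by
    refine circleIntegral.integral_congr hR fun w hw => ?_
    have : X w = 1 := Finset.prod_eq_one fun n _ => hχ1 n w (by
      by_contra! h
      have := hball n n.2 (mem_ball.2 h)
      rw [mem_sphere] at hw
      rw [mem_ball] at this
      linarith)
    simp [ψ, this]
  have hbound : ∀ w ∈ ball (0 : ℂ) R, ‖I * ψ' w 1 - ψ' w I‖ ≤ ∑ n : s, C n * ‖D n w‖ := by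
    intro w hw
    rw [hb, norm_mul, norm_I, one_mul]
    simp only [G, Finset.mul_sum]
    refine (norm_sum_le _ _).trans (Finset.sum_le_sum fun n _ => ?_)
    rw [norm_mul, norm_smul, Real.norm_eq_abs, abs_of_nonneg (hprod01 _ _).1]
    by_cases hD : D n w = 0
    · simp [hD]
    have hn := hDsupp n w hD
    by_cases hfar : ∀ m ∈ s, a m ≤ dist w (c m)
    · have h1 := hφC n n.2 w (mem_ball.2 hn.2) hfar
      calc ‖φ w‖ * ((∏ m ∈ Finset.univ.erase n, χ m w) * ‖D n w‖)
          ≤ C n * (1 * ‖D n w‖) := by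
            gcongr
            · exact mul_nonneg (hprod01 _ _).1 (norm_nonneg _)
            · exact hC n n.2
            · exact (hprod01 _ _).2
        _ = _ := by ring
    · push Not at hfar
      obtain ⟨m, hm, hlt⟩ := hfar
      have hmn : (⟨m, hm⟩ : s) ≠ n := by
        rintro rfl
        exact absurd hn.1 (not_lt.2 hlt.le)
      have : ∏ m ∈ Finset.univ.erase n, χ m w = 0 :=
        Finset.prod_eq_zero (i := ⟨m, hm⟩) (by simp [hmn]) (hχ0 _ w hlt.le)
      rw [this]
      simpa using mul_nonneg (hC n n.2) (norm_nonneg _)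
  have hint : Integrable (fun w => ∑ n : s, C n * ‖D n w‖) :=
    integrable_finsetSum _ fun n _ => (hDint n).const_mul _
  rw [hcirc, hgreen]
  calc ‖∫ w in ball (0 : ℂ) R, (I * ψ' w 1 - ψ' w I)‖
      ≤ ∫ w in ball (0 : ℂ) R, ∑ n : s, C n * ‖D n w‖ :=
        norm_integral_le_of_norm_le hint.integrableOn
          ((ae_restrict_iff' measurableSet_ball).2 (.of_forall hbound))
    _ ≤ ∫ w, ∑ n : s, C n * ‖D n w‖ :=
        setIntegral_le_integral hint (.of_forall fun w =>
          Finset.sum_nonneg fun n _ => mul_nonneg (hC n n.2) (norm_nonneg _))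
    _ = ∑ n : s, C n * ∫ w, ‖D n w‖ := by
        rw [integral_finsetSum _ fun n _ => (hDint n).const_mul _]
        simp_rw [integral_const_mul]
    _ ≤ ∑ n : s, C n * (2 * Real.pi * r n) :=
        Finset.sum_le_sum fun n _ => mul_le_mul_of_nonneg_left (hDle n) (hC n n.2)
    _ = 2 * Real.pi * ∑ n ∈ s, C n * r n := by
        rw [← Finset.sum_coe_sort s, Finset.mul_sum]
        exact Finset.sum_congr rfl fun n _ => by ring

/-! ### Contour integrals in an annulus -/

open Complex MeasureTheory Set Metric in
theorem circleIntegral_integral_swap {H : ℂ → ℂ → ℂ} {R₁ R₂ : ℝ} (h₁ : 0 ≤ R₁) (h₂ : 0 ≤ R₂)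
    (hH : ContinuousOn (Function.uncurry H) (sphere 0 R₁ ×ˢ sphere 0 R₂)) :
    (∮ z in C(0, R₁), ∮ w in C(0, R₂), H z w) = ∮ w in C(0, R₂), ∮ z in C(0, R₁), H z w := by
  let K : ℝ → ℝ → ℂ := fun x y =>
    deriv (circleMap 0 R₁) x * (deriv (circleMap 0 R₂) y * H (circleMap 0 R₁ x) (circleMap 0 R₂ y))
  have hK : Continuous (Function.uncurry K) := by
    have h : Continuous fun p : ℝ × ℝ =>
        Function.uncurry H (circleMap 0 R₁ p.1, circleMap 0 R₂ p.2) :=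
      hH.comp_continuous (by fun_prop) fun p =>
        ⟨circleMap_mem_sphere 0 h₁ _, circleMap_mem_sphere 0 h₂ _⟩
    simp only [K, Function.uncurry_def, deriv_circleMap] at h ⊢
    exact .mul (by fun_prop) (.mul (by fun_prop) h)
  have hpi : (0 : ℝ) ≤ 2 * Real.pi := by positivity
  have hswap := intervalIntegral_integral_swap (a := 0) (b := 2 * Real.pi)
    (μ := volume.restrict (uIoc 0 (2 * Real.pi))) (f := K) (by
      rw [Measure.prod_restrict]
      refine (hK.continuousOn.integrableOn_compact (isCompact_uIcc.prod isCompact_uIcc)).mono_set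
        (prod_mono uIoc_subset_uIcc uIoc_subset_uIcc))
  simp only [circleIntegral, smul_eq_mul, ← intervalIntegral.integral_const_mul]
  simp only [uIoc_of_le hpi, ← intervalIntegral.integral_of_le hpi] at hswap
  refine hswap.trans ?_
  refine intervalIntegral.integral_congr fun y _ => intervalIntegral.integral_congr fun x _ => ?_
  simp only [K]; ring

open Complex Set Metric in
theorem circleIntegral_div_sub_sq_eq {f : ℂ → ℂ} {U : Set ℂ} (hU : IsOpen U)
    (hf : DifferentiableOn ℂ f U) {ρ R : ℝ} (hρ : 0 < ρ) (hρR : ρ ≤ R)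
    (hA : closedBall 0 R \ ball 0 ρ ⊆ U) {z : ℂ} (hz : z ∉ closedBall (0 : ℂ) R \ ball 0 ρ) :
    (∮ w in C(0, R), f w / (w - z) ^ 2) = ∮ w in C(0, ρ), f w / (w - z) ^ 2 := by
  have h : ∀ w ∈ closedBall (0 : ℂ) R \ ball 0 ρ,
      DifferentiableAt ℂ (fun w => f w / (w - z) ^ 2) w := fun w hw =>
    (hf.differentiableAt (hU.mem_nhds (hA hw))).div (by fun_prop)
      (pow_ne_zero _ (sub_ne_zero.2 fun h => hz (h ▸ hw)))
  refine circleIntegral_eq_of_differentiable_on_annulus_off_countable hρ hρR countable_empty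
    (fun w hw => (h w hw).continuousAt.continuousWithinAt) fun w hw => h w ?_
  exact sdiff_subset_sdiff ball_subset_closedBall ball_subset_closedBall hw.1

open Complex Set Metric in
/-- Cauchy's formula for the derivative on an annulus. -/
theorem circleIntegral_div_sub_sq_sub {f : ℂ → ℂ} {U : Set ℂ} (hU : IsOpen U)
    (hf : DifferentiableOn ℂ f U) {ρ R : ℝ} (hρ : 0 < ρ)
    (hA : closedBall 0 R \ ball 0 ρ ⊆ U) {z : ℂ} (hρz : ρ < ‖z‖) (hzR : ‖z‖ < R) :
    (∮ w in C(0, R), f w / (w - z) ^ 2) - (∮ w in C(0, ρ), f w / (w - z) ^ 2) =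
      2 * Real.pi * I * deriv f z := by
  have hzA : z ∈ closedBall (0 : ℂ) R \ ball 0 ρ := by simp [hρz.le, hzR.le]
  have hρR : ρ < R := hρz.trans hzR
  have hR : 0 < R := hρ.trans hρR
  have hUz : U ∈ nhds z := hU.mem_nhds (hA hzA)
  let h : ℂ → ℂ := dslope (dslope f z) z
  have hh : DifferentiableOn ℂ h U :=
    (differentiableOn_dslope hUz).2 ((differentiableOn_dslope hUz).2 hf)
  have hh' : ∀ w ∈ closedBall (0 : ℂ) R \ ball 0 ρ, DifferentiableAt ℂ h w := fun w hw =>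
    hh.differentiableAt (hU.mem_nhds (hA hw))
  have heq : (∮ w in C(0, R), h w) = ∮ w in C(0, ρ), h w :=
    circleIntegral_eq_of_differentiable_on_annulus_off_countable hρ hρR.le countable_empty
      (fun w hw => (hh' w hw).continuousAt.continuousWithinAt) fun w hw =>
        hh' w (sdiff_subset_sdiff ball_subset_closedBall ball_subset_closedBall hw.1)
  -- Taylor expansion to first order at `z`, with the remainder `h` holomorphic.
  have hexp : ∀ w, w ≠ z → f w / (w - z) ^ 2 =
      h w + (deriv f z * (w - z)⁻¹ + f z * (w - z) ^ (-2 : ℤ)) := by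
    intro w hw
    have : w - z ≠ 0 := sub_ne_zero.2 hw
    simp only [h, dslope_of_ne _ hw, slope, dslope_same, vsub_eq_sub, smul_eq_mul, zpow_neg]
    norm_cast
    field_simp
    ring
  have hsplit : ∀ t, 0 < t → sphere (0 : ℂ) t ⊆ closedBall (0 : ℂ) R \ ball 0 ρ → t ≠ ‖z‖ →
      (∮ w in C(0, t), f w / (w - z) ^ 2) =
        (∮ w in C(0, t), h w) + deriv f z * ∮ w in C(0, t), (w - z)⁻¹ := by
    intro t ht hts htz
    have hne : ∀ w ∈ sphere (0 : ℂ) t, w - z ≠ 0 := by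
      intro w hw h0
      rw [sub_eq_zero] at h0
      exact htz (by simpa [h0] using hw.symm)
    have c1 : ContinuousOn h (sphere 0 t) := fun w hw =>
      (hh' w (hts hw)).continuousAt.continuousWithinAt
    have c2 : ContinuousOn (fun w => deriv f z * (w - z)⁻¹) (sphere 0 t) :=
      continuousOn_const.mul ((continuousOn_id.sub continuousOn_const).inv₀ hne)
    have c3 : ContinuousOn (fun w => f z * (w - z) ^ (-2 : ℤ)) (sphere 0 t) :=
      continuousOn_const.mul ((continuousOn_id.sub continuousOn_const).zpow₀ _
        fun w hw => Or.inl (hne w hw))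
    rw [circleIntegral.integral_congr ht.le fun w hw => hexp w (sub_ne_zero.1 (hne w hw)),
      circleIntegral.integral_add (c1.circleIntegrable ht.le)
        (ContinuousOn.circleIntegrable ht.le (f := fun w => _ * _ + _ * _) (c2.add c3)),
      circleIntegral.integral_add (c2.circleIntegrable ht.le) (c3.circleIntegrable ht.le),
      circleIntegral.integral_const_mul, circleIntegral.integral_const_mul,
      circleIntegral.integral_sub_zpow_of_ne (by norm_num), mul_zero, add_zero]
  have hout : (∮ w in C(0, ρ), (w - z)⁻¹) = 0 := by
    have hd : ∀ w ∈ closedBall (0 : ℂ) ρ, DifferentiableAt ℂ (fun w => (w - z)⁻¹) w := by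
      intro w hw
      refine DifferentiableAt.inv (by fun_prop) (sub_ne_zero.2 ?_)
      rintro rfl
      exact absurd (by simpa using hw) (not_le.2 hρz)
    exact circleIntegral_eq_zero_of_differentiable_on_off_countable hρ.le countable_empty
      (fun w hw => (hd w hw).continuousAt.continuousWithinAt)
      fun w hw => hd w (ball_subset_closedBall hw.1)
  rw [hsplit R hR (fun w hw => by simp_all [hρR.le]) hzR.ne',
    hsplit ρ hρ (fun w hw => by simp_all [hρR.le]) hρz.ne, heq, hout,
    circleIntegral.integral_sub_inv_of_mem_ball (by simpa using hzR)]
  ring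

open Complex Set Metric in
/-- Integration of `f' g` over the unit circle, expressed through the integrals of `f` and of `g`
against `(w - z)⁻²` over a smaller circle. Cauchy's formula on an annulus expresses `f'` by the
integrals over the circles of radii `R` and `ρ`; in the former, `g` is moved from radius `1` to
radius `ρ` and then `f` from radius `R` to radius `1`. -/
theorem circleIntegral_deriv_mul_eq {f g : ℂ → ℂ} {U : Set ℂ} (hU : IsOpen U)
    (hf : DifferentiableOn ℂ f U) (hg : DifferentiableOn ℂ g U) {ρ R : ℝ} (hρ : 0 < ρ)
    (hρ1 : ρ < 1) (hR : 1 < R) (hA : closedBall 0 R \ ball 0 ρ ⊆ U) :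
    2 * Real.pi * I * (∮ z in C(0, 1), deriv f z * g z) =
      (∮ z in C(0, 1), f z * ∮ w in C(0, ρ), g w / (w - z) ^ 2) -
        ∮ z in C(0, 1), g z * ∮ w in C(0, ρ), f w / (w - z) ^ 2 := by
  have hsub : ∀ t, ρ ≤ t → t ≤ R → sphere (0 : ℂ) t ⊆ U := fun t h1 h2 w hw =>
    hA (by simp_all)
  have hR0 : 0 < R := one_pos.trans hR
  have hker : ∀ s t, s ≠ t → ρ ≤ s → s ≤ R → ρ ≤ t → t ≤ R → ∀ u v : ℂ → ℂ,
      DifferentiableOn ℂ u U → DifferentiableOn ℂ v U →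
      ContinuousOn (Function.uncurry fun z w => u z * (v w / (w - z) ^ 2))
        (sphere (0 : ℂ) s ×ˢ sphere (0 : ℂ) t) := by
    intro s t hst hs1 hs2 ht1 ht2 u v hu hv
    refine (hu.continuousOn.comp continuousOn_fst fun p hp => hsub s hs1 hs2 hp.1).mul
      ((hv.continuousOn.comp continuousOn_snd fun p hp => hsub t ht1 ht2 hp.2).div
        (by fun_prop) ?_)
    rintro ⟨z, w⟩ ⟨hz, hw⟩
    refine pow_ne_zero _ (sub_ne_zero.2 ?_)
    intro hwz
    rw [mem_sphere] at hz hw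
    exact hst (hz.symm.trans (hwz ▸ hw))
  have hfub : ∀ s t, s ≠ t → ρ ≤ s → s ≤ R → ρ ≤ t → t ≤ R → ∀ u v : ℂ → ℂ,
      DifferentiableOn ℂ u U → DifferentiableOn ℂ v U →
      (∮ z in C(0, s), u z * ∮ w in C(0, t), v w / (w - z) ^ 2) =
        ∮ w in C(0, t), v w * ∮ z in C(0, s), u z / (z - w) ^ 2 := by
    intro s t hst hs1 hs2 ht1 ht2 u v hu hv
    simp only [← circleIntegral.integral_const_mul]
    rw [circleIntegral_integral_swap (hρ.le.trans hs1) (hρ.le.trans ht1)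
      (hker s t hst hs1 hs2 ht1 ht2 u v hu hv)]
    refine circleIntegral.integral_congr (hρ.le.trans ht1) fun w _ =>
      circleIntegral.integral_congr (hρ.le.trans hs1) fun z _ => ?_
    rw [show (w - z) ^ 2 = (z - w) ^ 2 by ring]
    ring
  have hcont : ∀ t, 1 ≠ t → ρ ≤ t → t ≤ R → ContinuousOn
      (fun z => g z * ∮ w in C(0, t), f w / (w - z) ^ 2) (sphere 0 1) := by
    intro t ht ht1 ht2
    refine (hg.continuousOn.mono (hsub 1 hρ1.le hR.le)).mul ?_
    have hd := hker 1 t ht hρ1.le hR.le ht1 ht2 (fun _ => 1) f (by fun_prop) hf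
    simp only [one_mul] at hd
    rw [continuousOn_iff_continuous_domRestrict]
    simp only [domRestrict_def, circleIntegral]
    refine intervalIntegral.continuous_parametric_intervalIntegral_of_continuous' ?_ _ _
    have h2 : Continuous fun p : sphere (0 : ℂ) 1 × ℝ => Function.uncurry
        (fun z w => f w / (w - z) ^ 2) ((p.1 : ℂ), circleMap 0 t p.2) :=
      hd.comp_continuous (by fun_prop) fun p =>
        ⟨p.1.2, circleMap_mem_sphere 0 (hρ.le.trans ht1) _⟩
    simp only [deriv_circleMap]
    have h3 : Continuous fun p : sphere (0 : ℂ) 1 × ℝ => circleMap 0 t p.2 * I := by fun_prop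
    exact h3.mul h2
  calc 2 * Real.pi * I * (∮ z in C(0, 1), deriv f z * g z)
      = ∮ z in C(0, 1), (g z * (∮ w in C(0, R), f w / (w - z) ^ 2) -
          g z * ∮ w in C(0, ρ), f w / (w - z) ^ 2) := by
        rw [← circleIntegral.integral_const_mul]
        refine circleIntegral.integral_congr zero_le_one fun z hz => ?_
        have hz1 : ‖z‖ = 1 := by simpa using hz
        have := circleIntegral_div_sub_sq_sub hU hf hρ hA (by rwa [hz1]) (by rwa [hz1])
        simp only [← mul_sub, this]; ring
    _ = (∮ z in C(0, 1), g z * ∮ w in C(0, R), f w / (w - z) ^ 2) -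
          ∮ z in C(0, 1), g z * ∮ w in C(0, ρ), f w / (w - z) ^ 2 :=
        circleIntegral.integral_sub
          ((hcont R hR.ne (hρ1.trans hR).le le_rfl).circleIntegrable zero_le_one)
          ((hcont ρ hρ1.ne' le_rfl (hρ1.trans hR).le).circleIntegrable zero_le_one)
    _ = _ := by
        congr 1
        calc (∮ z in C(0, 1), g z * ∮ w in C(0, R), f w / (w - z) ^ 2)
            = ∮ w in C(0, R), f w * ∮ z in C(0, 1), g z / (z - w) ^ 2 :=
              hfub 1 R hR.ne hρ1.le hR.le (hρ1.trans hR).le le_rfl g f hg hf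
          _ = ∮ w in C(0, R), f w * ∮ z in C(0, ρ), g z / (z - w) ^ 2 := by
              refine circleIntegral.integral_congr hR0.le fun w hw => ?_
              have hw1 : ‖w‖ = R := by simpa using hw
              rw [circleIntegral_div_sub_sq_eq hU hg hρ hρ1.le
                ((sdiff_subset_sdiff_left (closedBall_subset_closedBall hR.le)).trans hA)
                (by simp [hw1, hR])]
          _ = ∮ z in C(0, ρ), g z * ∮ w in C(0, R), f w / (w - z) ^ 2 :=
              hfub R ρ (hρ1.trans hR).ne' (hρ1.trans hR).le le_rfl le_rfl (hρ1.trans hR).le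
                f g hf hg
          _ = ∮ z in C(0, ρ), g z * ∮ w in C(0, 1), f w / (w - z) ^ 2 := by
              refine circleIntegral.integral_congr hρ.le fun z hz => ?_
              have hz1 : ‖z‖ = ρ := by simpa using hz
              rw [circleIntegral_div_sub_sq_eq hU hf one_pos hR.le
                ((sdiff_subset_sdiff_right (ball_subset_ball hρ1.le)).trans hA)
                (by simp [hz1, hρ1])]
          _ = ∮ w in C(0, 1), f w * ∮ z in C(0, ρ), g z / (z - w) ^ 2 :=
              hfub ρ 1 hρ1.ne le_rfl (hρ1.trans hR).le hρ1.le hR.le g f hg hf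

/-! ### The estimate for finitely many discs -/

open Complex Set Metric in
/-- The estimate for finitely many discs, slightly shrunk: `f` and `g` are holomorphic and bounded by
`A` and `B` near the closed unit disc with the discs of radii `a n < r n` removed. -/
theorem norm_circleIntegral_deriv_mul_le {N : ℕ} (c : ℕ → ℂ) (a r s : ℕ → ℝ)
    (ha : ∀ n, 0 ≤ a n) (har : ∀ n, a n < r n) (hs : ∀ n, 0 < s n)
    (hball : ∀ n, closure (ball (c n) (r n)) ⊆ ball 0 1)
    (hdist : ∀ n, ∀ w ∈ ball (c n) (r n), ∀ z ∈ sphere (0 : ℂ) 1, s n ≤ dist w z)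
    {V : Set ℂ} (hV : IsOpen V) {f g : ℂ → ℂ} (hf : DifferentiableOn ℂ f V)
    (hg : DifferentiableOn ℂ g V)
    (hKV : ∀ w ∈ closedBall (0 : ℂ) 1, (∀ n < N, a n ≤ dist w (c n)) → w ∈ V)
    {A B : ℝ} (hA : 0 ≤ A) (hB : 0 ≤ B) (hfA : ∀ w ∈ V, ‖f w‖ ≤ A) (hgB : ∀ w ∈ V, ‖g w‖ ≤ B) :
    ‖∮ z in C(0, 1), deriv f z * g z‖ ≤
      4 * Real.pi * A * B * ∑ n ∈ Finset.range N, r n / s n ^ 2 := by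
  obtain ⟨ρ, hρ0, hρ1, hρ⟩ : ∃ ρ : ℝ, 0 < ρ ∧ ρ < 1 ∧ ∀ n < N, ball (c n) (r n) ⊆ ball 0 ρ := by
    have hcomp : IsCompact (insert 0 (⋃ n ∈ Finset.range N, closure (ball (c n) (r n)))) :=
      ((Finset.range N).isCompact_biUnion fun n _ => isBounded_ball.isCompact_closure).insert 0
    obtain ⟨ρ, hρ1, hρ⟩ := exists_lt_subset_ball hcomp.isClosed (x := (0 : ℂ)) (r := 1) (by
      refine insert_subset (by simp) (iUnion₂_subset fun n _ => hball n))
    refine ⟨ρ, by simpa using hρ (mem_insert _ _), hρ1, fun n hn => ?_⟩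
    refine subset_closure.trans (Subset.trans ?_ hρ)
    exact (subset_biUnion_of_mem (u := fun n => closure (ball (c n) (r n)))
      (Finset.mem_coe.2 (Finset.mem_range.2 hn))).trans (subset_insert _ _)
  have hout : ∀ w : ℂ, ρ ≤ ‖w‖ → ∀ n < N, a n ≤ dist w (c n) := by
    intro w hw n hn
    by_contra! h
    have := hρ n hn (mem_ball.2 (h.trans (har n)))
    rw [mem_ball, dist_zero_right] at this
    linarith
  obtain ⟨R, hR1, hR⟩ : ∃ R : ℝ, 1 < R ∧ closedBall (0 : ℂ) R \ ball 0 ρ ⊆ V := by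
    have hsub : sphere (0 : ℂ) 1 ⊆ V := fun w hw =>
      hKV w (sphere_subset_closedBall hw) (hout w (by simp_all [hρ1.le]))
    obtain ⟨δ, hδ, hδV⟩ := (isCompact_sphere (0 : ℂ) 1).exists_thickening_subset_open hV hsub
    refine ⟨1 + δ / 2, by linarith, fun w hw => ?_⟩
    have hw1 : ‖w‖ ≤ 1 + δ / 2 := by simpa using hw.1
    have hw2 : ρ ≤ ‖w‖ := by simpa using hw.2
    rcases le_or_gt ‖w‖ 1 with h | h
    · exact hKV w (by simpa using h) (hout w hw2)
    · have hw0 : (‖w‖ : ℂ) ≠ 0 := by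
        have : ‖w‖ ≠ 0 := by linarith
        exact_mod_cast this
      refine hδV (mem_thickening_iff.2 ⟨w / ‖w‖, ?_, ?_⟩)
      · have : ‖w‖ ≠ 0 := by linarith
        simp [this]
      · have e : w - w / ‖w‖ = ((‖w‖ - 1 : ℝ) : ℂ) * (w / ‖w‖) := by
          push_cast; field_simp
        rw [dist_eq_norm, e, norm_mul, norm_real, Real.norm_eq_abs, abs_of_pos (by linarith)]
        have : ‖w / (‖w‖ : ℂ)‖ = 1 := by
          have : ‖w‖ ≠ 0 := by linarith
          simp [this]
        rw [this]; linarith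
  have hcauchy : ∀ {h : ℂ → ℂ} {M : ℝ}, DifferentiableOn ℂ h V → 0 ≤ M → (∀ w ∈ V, ‖h w‖ ≤ M) →
      ∀ z ∈ sphere (0 : ℂ) 1, ‖∮ w in C(0, ρ), h w / (w - z) ^ 2‖ ≤
        2 * Real.pi * ∑ n ∈ Finset.range N, M / s n ^ 2 * r n := by
    intro h M hh hM hhM z hz
    have hz1 : ‖z‖ = 1 := by simpa using hz
    have hmem : ∀ w ∈ closedBall (0 : ℂ) 1, (∀ n ∈ Finset.range N, a n ≤ dist w (c n)) → w ∈ V :=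
      fun w hw hw' => hKV w hw fun n hn => hw' n (Finset.mem_range.2 hn)
    refine norm_circleIntegral_le_sum_radii _ c a r (fun n => M / s n ^ 2) (fun n _ => ha n)
      (fun n _ => har n) hρ0.le (fun n hn => hρ n (Finset.mem_range.1 hn)) _
      (fun n _ => by positivity) ?_ ?_
    · intro w hw hw'
      refine (hh.differentiableAt (hV.mem_nhds
        (hmem w (closedBall_subset_closedBall hρ1.le hw) hw'))).div (by fun_prop) ?_
      refine pow_ne_zero _ (sub_ne_zero.2 ?_)
      rintro rfl
      rw [mem_closedBall, dist_zero_right] at hw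
      linarith
    · intro n hn w hw hw'
      have hwV := hmem w (ball_subset_closedBall (hball n (subset_closure hw))) hw'
      rw [norm_div, norm_pow, ← dist_eq_norm]
      have := hdist n w hw z hz
      have := hs n
      gcongr
      exact hhM w hwV
  have hS : ∀ M : ℝ, ∑ n ∈ Finset.range N, M / s n ^ 2 * r n =
      M * ∑ n ∈ Finset.range N, r n / s n ^ 2 := by
    intro M
    rw [Finset.mul_sum]
    exact Finset.sum_congr rfl fun n _ => by ring
  set S := ∑ n ∈ Finset.range N, r n / s n ^ 2 with hSdef
  have hTV : sphere (0 : ℂ) 1 ⊆ V := fun w hw =>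
    hKV w (sphere_subset_closedBall hw) (hout w (by simp_all [hρ1.le]))
  have hb1 : ‖∮ z in C(0, 1), f z * ∮ w in C(0, ρ), g w / (w - z) ^ 2‖ ≤
      2 * Real.pi * 1 * (A * (2 * Real.pi * (B * S))) := by
    refine circleIntegral.norm_integral_le_of_norm_le_const zero_le_one fun z hz => ?_
    rw [norm_mul, ← hS]
    exact mul_le_mul (hfA z (hTV hz)) (hcauchy hg hB hgB z hz) (norm_nonneg _) hA
  have hb2 : ‖∮ z in C(0, 1), g z * ∮ w in C(0, ρ), f w / (w - z) ^ 2‖ ≤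
      2 * Real.pi * 1 * (B * (2 * Real.pi * (A * S))) := by
    refine circleIntegral.norm_integral_le_of_norm_le_const zero_le_one fun z hz => ?_
    rw [norm_mul, ← hS]
    exact mul_le_mul (hgB z (hTV hz)) (hcauchy hf hA hfA z hz) (norm_nonneg _) hB
  have hid := circleIntegral_deriv_mul_eq hV hf hg hρ0 hρ1 hR1 hR
  have hnorm := (congrArg norm hid).le.trans ((norm_sub_le _ _).trans (add_le_add hb1 hb2))
  rw [norm_mul] at hnorm
  have h2pi : ‖(2 * Real.pi * I : ℂ)‖ = 2 * Real.pi := by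
    simp [abs_of_pos Real.pi_pos]
  rw [h2pi] at hnorm
  refine le_of_mul_le_mul_left (hnorm.trans_eq ?_) Real.two_pi_pos
  ring

/-! ### The Swiss cheese -/

namespace SwissCheese

open Complex Set Metric in
theorem setDist_le_dist {A B : Set ℂ} {w z : ℂ} (hw : w ∈ A) (hz : z ∈ B) :
    setDist A B ≤ dist w z :=
  ciInf_le (f := fun x : A × B => dist (x.1 : ℂ) (x.2 : ℂ))
    ⟨0, by rintro _ ⟨x, rfl⟩; exact dist_nonneg⟩ (⟨w, hw⟩, ⟨z, hz⟩)

open Complex Set Metric in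
theorem setDist_ball_sphere_pos {c : ℂ} {r : ℝ} (hr : 0 < r)
    (hD : closure (ball c r) ⊆ ball (0 : ℂ) 1) :
    0 < setDist (ball c r) (sphere (0 : ℂ) 1) := by
  obtain ⟨ρ, hρ1, hρ⟩ := exists_lt_subset_ball isClosed_closure hD
  have : Nonempty (ball c r) := ⟨c, mem_ball_self hr⟩
  have : Nonempty (sphere (0 : ℂ) 1) := ⟨1, by simp⟩
  refine (sub_pos.2 hρ1).trans_le (le_ciInf ?_)
  rintro ⟨⟨w, hw⟩, ⟨z, hz⟩⟩
  have h1 : ‖w‖ < ρ := by simpa using hρ (subset_closure hw)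
  have h2 : ‖z‖ = 1 := by simpa using hz
  have h3 := norm_sub_norm_le z w
  rw [dist_comm, dist_eq_norm]
  simp only
  linarith

open Complex Set Metric in
theorem sphere_subset_cheese {c : ℕ → ℂ} {r : ℕ → ℝ}
    (hD : ∀ n, closure (ball (c n) (r n)) ⊆ ball (0 : ℂ) 1) :
    sphere (0 : ℂ) 1 ⊆ cheese c r := by
  refine fun z hz => ⟨sphere_subset_closedBall hz, ?_⟩
  rw [mem_iUnion]
  rintro ⟨n, hn⟩
  have := hD n (subset_closure hn)
  rw [mem_sphere] at hz
  rw [mem_ball] at this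
  linarith

open Complex Set Metric in
theorem isCompact_cheese (c : ℕ → ℂ) (r : ℕ → ℝ) : IsCompact (cheese c r) :=
  (isCompact_closedBall 0 1).diff (isOpen_iUnion fun _ => isOpen_ball)

open Set Filter in
theorem accPt_cheese {c : ℕ → ℂ} {r : ℕ → ℝ}
    (hD : ∀ n, closure (Metric.ball (c n) (r n)) ⊆ Metric.ball (0 : ℂ) 1) {z : ℂ}
    (hz : z ∈ Metric.sphere (0 : ℂ) 1) : AccPt z (principal (cheese c r)) := by
  have hp : Preperfect (Metric.sphere (0 : ℂ) 1) :=
    (isPreconnected_sphere (by simp [Complex.rank_real_complex]) 0 1).preperfect_of_nontrivial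
      ⟨1, by simp, -1, by simp, by norm_num⟩
  exact (hp z hz).mono (principal_mono.2 (sphere_subset_cheese hD))

open Complex Set Metric in
/-- A neighbourhood of the cheese contains what remains when only finitely many, slightly
shrunk, discs are removed. -/
theorem exists_finite_shrunk_discs {c : ℕ → ℂ} {r : ℕ → ℝ} (hr : ∀ n, 0 < r n) {V : Set ℂ}
    (hV : IsOpen V) (hX : cheese c r ⊆ V) :
    ∃ (N : ℕ) (t : ℝ), 0 ≤ t ∧ t < 1 ∧
      ∀ w ∈ closedBall (0 : ℂ) 1, (∀ n < N, t * r n ≤ dist w (c n)) → w ∈ V := by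
  let t : ℕ → ℝ := fun N => 1 - 1 / (N + 1)
  have ht : Monotone t := fun M N h => by simp only [t]; gcongr
  have htlim : Filter.Tendsto t Filter.atTop (nhds 1) := by
    simpa [t] using (tendsto_one_div_add_atTop_nhds_zero_nat (𝕜 := ℝ)).const_sub 1
  let U : ℕ → Set ℂ := fun N => ⋃ n ∈ Finset.range N, ball (c n) (t N * r n)
  have hU : Monotone U := fun M N h => by
    refine iUnion₂_subset fun n hn => Subset.trans (ball_subset_ball ?_)
      (subset_biUnion_of_mem (u := fun n => ball (c n) (t N * r n)) (x := n) ?_)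
    · exact mul_le_mul_of_nonneg_right (ht h) (hr n).le
    · exact Finset.mem_coe.2 (Finset.mem_range.2 ((Finset.mem_range.1 hn).trans_le h))
  obtain ⟨N, hN⟩ := ((isCompact_closedBall (0 : ℂ) 1).diff hV).elim_directed_cover U
    (fun N => isOpen_biUnion fun _ _ => isOpen_ball) (by
      rintro w ⟨hw, hwV⟩
      obtain ⟨n, hn⟩ : ∃ n, w ∈ ball (c n) (r n) := by
        by_contra h
        exact hwV (hX ⟨hw, by simpa using h⟩)
      have hlim := htlim.mul_const (r n)
      rw [one_mul] at hlim
      obtain ⟨N, hN, hnN⟩ := ((hlim.eventually (lt_mem_nhds (mem_ball.1 hn))).and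
        (Filter.eventually_gt_atTop n)).exists
      exact mem_iUnion.2 ⟨N, mem_biUnion (Finset.mem_coe.2 (Finset.mem_range.2 hnN))
        (mem_ball.2 hN)⟩)
    hU.directed_le
  refine ⟨N, t N, ?_, ?_, fun w hw hfar => ?_⟩
  · have : (1 : ℝ) / (N + 1) ≤ 1 := by rw [div_le_one (by positivity)]; simp
    simp only [t]; linarith
  · have : (0 : ℝ) < 1 / (N + 1) := by positivity
    simp only [t]; linarith
  · by_contra hwV
    obtain ⟨n, hn, hw'⟩ := mem_iUnion₂.1 (hN ⟨hw, hwV⟩)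
    exact absurd (mem_ball.1 hw') (not_lt.2 (hfar n (Finset.mem_range.1 hn)))

open Complex Set Metric in
/-- The supremum defining the norm is a true one, since functions in `R0 X` are bounded on a compact
`X`. -/
theorem norm_le_unifNorm {X : Set ℂ} (hX : IsCompact X) {f : ℂ → ℂ} (hf : f ∈ R0 X)
    {z : ℂ} (hz : z ∈ X) : ‖f z‖ ≤ unifNorm X f := by
  obtain ⟨p, q, hq, hfpq⟩ := hf
  have hc : ContinuousOn (fun w => p.eval w / q.eval w) X :=
    p.continuous.continuousOn.div q.continuous.continuousOn hq
  obtain ⟨C, hC⟩ := hX.exists_bound_of_continuousOn hc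
  refine le_ciSup (f := fun x : X => ‖f x‖) ⟨C, ?_⟩ ⟨z, hz⟩
  rintro _ ⟨x, rfl⟩
  simpa only [hfpq x x.2] using hC x x.2

end SwissCheese

/-! ### The estimate for the Swiss cheese -/

theorem lemma2p1 (c : ℕ → ℂ) (r : ℕ → ℝ) (hr : ∀ n, 0 < r n)
    (hD : ∀ n, closure (Metric.ball (c n) (r n)) ⊆ Metric.ball (0 : ℂ) 1)
    (s : ℕ → ℝ)
    (hs : ∀ n, s n = SwissCheese.setDist (Metric.ball (c n) (r n)) (Metric.sphere (0 : ℂ) 1))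
    (X : Set ℂ) (hX : X = SwissCheese.cheese c r)
    (f g : ℂ → ℂ) (hf : f ∈ SwissCheese.R0 X) (hg : g ∈ SwissCheese.R0 X) :
    ENNReal.ofReal ‖∮ z in C(0, 1), derivWithin f X z * g z‖ ≤
      ENNReal.ofReal (4 * Real.pi * SwissCheese.unifNorm X f * SwissCheese.unifNorm X g) *
        ∑' n, ENNReal.ofReal (r n / s n ^ 2) := by
  subst hX
  set X := SwissCheese.cheese c r
  have hTX : Metric.sphere (0 : ℂ) 1 ⊆ X := SwissCheese.sphere_subset_cheese hD
  have hf' := fun z (hz : z ∈ X) =>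
    SwissCheese.norm_le_unifNorm (SwissCheese.isCompact_cheese c r) hf hz
  have hg' := fun z (hz : z ∈ X) =>
    SwissCheese.norm_le_unifNorm (SwissCheese.isCompact_cheese c r) hg hz
  obtain ⟨p₁, q₁, hq₁, hfe⟩ := hf
  obtain ⟨p₂, q₂, hq₂, hge⟩ := hg
  have hA0 : 0 ≤ SwissCheese.unifNorm X f := Real.iSup_nonneg fun _ => norm_nonneg _
  have hB0 : 0 ≤ SwissCheese.unifNorm X g := Real.iSup_nonneg fun _ => norm_nonneg _
  set A := SwissCheese.unifNorm X f
  set B := SwissCheese.unifNorm X g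
  -- Here `0 * ∞ = 0`, so vanishing norms need an argument of their own.
  rcases hA0.eq_or_lt with hA | hA
  · have h0 : ∀ z ∈ X, f z = 0 := fun z hz => norm_le_zero_iff.1 ((hf' z hz).trans hA.ge)
    have : (∮ z in C(0, 1), derivWithin f X z * g z) = ∮ _ in C(0, 1), (0 : ℂ) := by
      refine circleIntegral.integral_congr zero_le_one fun z hz => ?_
      have : derivWithin f X z = derivWithin (fun _ => (0 : ℂ)) X z :=
        derivWithin_congr h0 (h0 z (hTX hz))
      simp [this]
    rw [this]
    simp [circleIntegral]
  rcases hB0.eq_or_lt with hB | hB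
  · have h0 : ∀ z ∈ X, g z = 0 := fun z hz => norm_le_zero_iff.1 ((hg' z hz).trans hB.ge)
    have : (∮ z in C(0, 1), derivWithin f X z * g z) = ∮ _ in C(0, 1), (0 : ℂ) := by
      refine circleIntegral.integral_congr zero_le_one fun z hz => ?_
      simp [h0 z (hTX hz)]
    rw [this]
    simp [circleIntegral]
  have hAB : 0 < 4 * Real.pi * A * B := by positivity
  rcases eq_or_ne (∑' n, ENNReal.ofReal (r n / s n ^ 2)) ⊤ with htop | htop
  · rw [htop, ENNReal.mul_top (by simpa using hAB)]
    exact le_top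
  have hspos : ∀ n, 0 < s n := fun n => hs n ▸ SwissCheese.setDist_ball_sphere_pos (hr n) (hD n)
  set S := (∑' n, ENNReal.ofReal (r n / s n ^ 2)).toReal with hSdef
  have hpart : ∀ N, ∑ n ∈ Finset.range N, r n / s n ^ 2 ≤ S := by
    intro N
    rw [hSdef, ← ENNReal.ofReal_le_iff_le_toReal htop, ENNReal.ofReal_sum_of_nonneg
      fun n _ => div_nonneg (hr n).le (sq_nonneg _)]
    exact ENNReal.sum_le_tsum _
  rw [← ENNReal.ofReal_toReal htop, ← ENNReal.ofReal_mul hAB.le]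
  refine ENNReal.ofReal_le_ofReal ?_
  let F : ℂ → ℂ := fun w => p₁.eval w / q₁.eval w
  let G : ℂ → ℂ := fun w => p₂.eval w / q₂.eval w
  have hFG : (∮ z in C(0, 1), derivWithin f X z * g z) = ∮ z in C(0, 1), deriv F z * G z := by
    refine circleIntegral.integral_congr zero_le_one fun z hz => ?_
    simp only [hge z (hTX hz), SwissCheese.derivWithin_eq hq₁ hfe (hTX hz)
      (SwissCheese.accPt_cheese hD hz), F, G]
  rw [hFG]
  have heps : ∀ ε : ℝ, 0 < ε →
      ‖∮ z in C(0, 1), deriv F z * G z‖ ≤ 4 * Real.pi * (A + ε) * (B + ε) * S := by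
    intro ε hε
    let W : Set ℂ := {w | q₁.eval w ≠ 0} ∩ {w | q₂.eval w ≠ 0}
    have hW : IsOpen W := (isOpen_ne.preimage q₁.continuous).inter
      (isOpen_ne.preimage q₂.continuous)
    have hFd : DifferentiableOn ℂ F W :=
      p₁.differentiable.differentiableOn.div q₁.differentiable.differentiableOn fun w hw => hw.1
    have hGd : DifferentiableOn ℂ G W :=
      p₂.differentiable.differentiableOn.div q₂.differentiable.differentiableOn fun w hw => hw.2
    let V : Set ℂ := W ∩ (fun w => (‖F w‖, ‖G w‖)) ⁻¹' (Set.Iio (A + ε) ×ˢ Set.Iio (B + ε))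
    have hV : IsOpen V := (hFd.continuousOn.norm.prodMk hGd.continuousOn.norm).isOpen_inter_preimage
      hW (isOpen_Iio.prod isOpen_Iio)
    have hXV : X ⊆ V := by
      intro w hw
      refine ⟨⟨hq₁ w hw, hq₂ w hw⟩, ?_, ?_⟩
      · have := hf' w hw
        rw [hfe w hw] at this
        exact this.trans_lt (lt_add_of_pos_right _ hε)
      · have := hg' w hw
        rw [hge w hw] at this
        exact this.trans_lt (lt_add_of_pos_right _ hε)
    obtain ⟨N, t, ht0, ht1, hN⟩ := SwissCheese.exists_finite_shrunk_discs hr hV hXV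
    refine (norm_circleIntegral_deriv_mul_le (N := N) c (fun n => t * r n) r s
      (fun n => mul_nonneg ht0 (hr n).le) (fun n => mul_lt_of_lt_one_left (hr n) ht1) hspos hD
      (fun n w hw z hz => hs n ▸ SwissCheese.setDist_le_dist hw hz) hV
      (hFd.mono Set.inter_subset_left) (hGd.mono Set.inter_subset_left) hN
      (by positivity) (by positivity) (fun w hw => (Set.mem_Iio.1 hw.2.1).le)
      (fun w hw => (Set.mem_Iio.1 hw.2.2).le)).trans ?_
    exact mul_le_mul_of_nonneg_left (hpart N) (by positivity)
  have hlim : Filter.Tendsto (fun ε : ℝ => 4 * Real.pi * (A + ε) * (B + ε) * S)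
      (nhdsWithin 0 (Set.Ioi 0)) (nhds (4 * Real.pi * A * B * S)) := by
    have : Continuous fun ε : ℝ => 4 * Real.pi * (A + ε) * (B + ε) * S := by fun_prop
    simpa using (this.tendsto 0).mono_left nhdsWithin_le_nhds
  exact ge_of_tendsto hlim (Filter.eventually_of_mem self_mem_nhdsWithin heps)
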